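/- For a finite simple graph $G$ on vertex set $V(G)$, let $\mathcal{S}(G)$ be the set of real symmetric matrices $A=[a_{ij}]$, with rows and columns indexed by $V(G)$, such that for $i\neq j$, $a_{ij}\neq 0$ if and only if $ij\in E(G)$ (the diagonal entries are unrestricted). Let $q(A)$ denote the number of distinct eigenvalues of $A$, and let $q(G)=\min\{q(A): A\in\mathcal{S}(G)\}$. The strong product $G\boxtimes G'$ has vertex set $V(G)\times V(G')$, and $(u,u')$ and $(v,v')$ are adjacent if and only if one of the following holds: $u=v$ and $u'v'\in E(G')$; or $u'=v'$ and $uv\in E(G)$; or $uv\in E(G)$ and $u'v'\in E(G')$. Let $P_n$ denote the path on $n$ vertices. Then for all integers $s'\ge s\ge 2$, \[ s\;\le\; q(P_s\boxtimes P_{s'})\;\le\; \begin{cases} s+s'-2 & \text{if } s \text{ and } s' \text{ are both even},\\ s+s'-1 & \text{otherwise.} \end{cases} \] -/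

import Mathlib

namespace SimpleGraph

/-- The strong product `G ⊠ G'`. -/
def strongProd {V W : Type*} (G : SimpleGraph V) (G' : SimpleGraph W) : SimpleGraph (V × W) where
  Adj x y := (x.1 = y.1 ∧ G'.Adj x.2 y.2) ∨ (x.2 = y.2 ∧ G.Adj x.1 y.1) ∨
    (G'.Adj x.2 y.2 ∧ G.Adj x.1 y.1)
  symm := ⟨by
    rintro x y (⟨h, h'⟩ | ⟨h, h'⟩ | ⟨h, h'⟩)
    · exact Or.inl ⟨h.symm, h'.symm⟩
    · exact Or.inr (Or.inl ⟨h.symm, h'.symm⟩)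
    · exact Or.inr (Or.inr ⟨h.symm, h'.symm⟩)⟩
  loopless := ⟨by
    rintro x (⟨-, h⟩ | ⟨-, h⟩ | ⟨-, h⟩) <;> exact h.ne rfl⟩

/-- The set `S(G)` of real symmetric matrices whose off-diagonal nonzero pattern is given by the
edges of `G`; the diagonal is unrestricted. -/
def symmMatrices {V : Type*} (G : SimpleGraph V) : Set (Matrix V V ℝ) :=
  {A | A.IsSymm ∧ ∀ i j, i ≠ j → (A i j ≠ 0 ↔ G.Adj i j)}

end SimpleGraph

/-- The set of distinct (real) eigenvalues of a real square matrix. -/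
def Matrix.distinctEigenvalues {V : Type*} [Fintype V] [DecidableEq V] (A : Matrix V V ℝ) : Set ℝ :=
  {μ | Module.End.HasEigenvalue (Matrix.toLin' A) μ}

/-- The number `q(A)` of distinct eigenvalues of `A`. -/
noncomputable def Matrix.numDistinctEigenvalues {V : Type*} [Fintype V] [DecidableEq V]
    (A : Matrix V V ℝ) : ℕ :=
  A.distinctEigenvalues.ncard

/-- `q(A)` is an honest count: the set of distinct eigenvalues is finite. -/
theorem Matrix.finite_distinctEigenvalues {V : Type*} [Fintype V] [DecidableEq V]
    (A : Matrix V V ℝ) : A.distinctEigenvalues.Finite :=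
  Module.End.finite_hasEigenvalue (Matrix.toLin' A)

namespace SimpleGraph

/-- The minimum number `q(G)` of distinct eigenvalues over all matrices in `S(G)`. -/
noncomputable def minDistinctEigenvalues {V : Type*} [Fintype V] [DecidableEq V]
    (G : SimpleGraph V) : ℕ :=
  sInf {k | ∃ A ∈ G.symmMatrices, A.numDistinctEigenvalues = k}

/-- `S(G)` is nonempty: it contains the adjacency matrix. -/
theorem symmMatrices_nonempty {V : Type*} (G : SimpleGraph V) : G.symmMatrices.Nonempty := by
  classical
  refine ⟨G.adjMatrix ℝ, G.isSymm_adjMatrix, fun i j _ => ?_⟩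
  simp [SimpleGraph.adjMatrix_apply]

/-- The infimum defining `q(G)` is an attained minimum. -/
theorem isLeast_minDistinctEigenvalues {V : Type*} [Fintype V] [DecidableEq V]
    (G : SimpleGraph V) :
    IsLeast {k | ∃ A ∈ G.symmMatrices, A.numDistinctEigenvalues = k} G.minDistinctEigenvalues := by
  obtain ⟨A, hA⟩ := G.symmMatrices_nonempty
  exact ⟨Nat.sInf_mem ⟨_, A, hA, rfl⟩, fun _ hk => Nat.sInf_le hk⟩

end SimpleGraph

/-!
Lower bound: if `w` is the only walk of length at most `d = w.length` from `u` to `v` and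
`A ∈ S(G)`, then the `(u, v)` entry vanishes for `1, A, …, A ^ (d - 1)` but not for `A ^ d`, so no
monic polynomial of degree `d` annihilates `A`; as `A` is diagonalizable, it has more than `d`
eigenvalues. The diagonal of the grid is such a walk.

Upper bound: if `A ∈ S(P_m)` and `B ∈ S(P_n)` have no zero on the diagonal, then the Kronecker
product `A ⊗ B` lies in `S(P_m ⊠ P_n)` and its eigenvalues are the products of those of `A` and
`B`. Any finite set of nonzero reals is the spectrum of such a path matrix. Indeed, let `D` be the
diagonal matrix of these numbers `x i`. In the basis obtained by Gram–Schmidt from vectors with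
`D f_k = x_k f_k + ε f_{k+1}`, `D` is upper Hessenberg, hence by symmetry tridiagonal. Its
off-diagonal entries are nonzero for `ε ≠ 0`, and for small `ε` its diagonal is close to the `x i`,
since at `ε = 0` the `f_k` are orthogonal eigenvectors. Taking powers of two, or powers of two with
both signs, makes the set of products small.
-/

open Finset Matrix Kronecker Pointwise
open InnerProductSpace (gramSchmidt gramSchmidtNormed)
open Polynomial (C X aeval)
open SimpleGraph (pathGraph)

section GramSchmidt

variable {𝕜 E : Type*} [RCLike 𝕜] [NormedAddCommGroup E] [InnerProductSpace 𝕜 E]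

local notation "⟪" x ", " y "⟫" => inner 𝕜 x y

lemma continuousAt_gramSchmidt {ι Y : Type*} [LinearOrder ι] [LocallyFiniteOrderBot ι]
    [WellFoundedLT ι] [TopologicalSpace Y] {f : Y → ι → E} {t : Y}
    (hf : ∀ k, ContinuousAt (fun s => f s k) t) {k : ι}
    (hne : ∀ j < k, gramSchmidt 𝕜 (f t) j ≠ 0) :
    ContinuousAt (fun s => gramSchmidt 𝕜 (f s) k) t := by
  induction k using WellFoundedLT.induction with
  | ind k ih =>
    have hcoeff : ∀ j ∈ Iio k, ContinuousAt (fun s =>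
        (𝕜 ∙ gramSchmidt 𝕜 (f s) j).starProjection (f s k)) t := by
      intro j hj
      have hjk := mem_Iio.1 hj
      have hq := ih j hjk fun i hi => hne i (hi.trans hjk)
      have hinner : ContinuousAt (fun s => ⟪gramSchmidt 𝕜 (f s) j, f s k⟫) t :=
        Filter.Tendsto.inner hq (hf k)
      simp only [Submodule.starProjection_singleton]
      refine (hinner.div (by fun_prop) ?_).smul hq
      simpa using hne j hjk
    simp only [InnerProductSpace.gramSchmidt_def 𝕜 (f _) k]
    exact (hf k).sub (tendsto_finsetSum _ hcoeff)

lemma inner_gramSchmidt_eq_zero_of_mem_span {ι : Type*} [LinearOrder ι] [LocallyFiniteOrderBot ι]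
    [WellFoundedLT ι] {f : ι → E} {k : ι} {y : E} (hy : y ∈ Submodule.span 𝕜 (f '' Set.Iio k)) :
    ⟪gramSchmidt 𝕜 f k, y⟫ = 0 := by
  induction hy using Submodule.span_induction with
  | mem _ h =>
    obtain ⟨i, hi, rfl⟩ := h
    exact InnerProductSpace.gramSchmidt_inv_triangular 𝕜 f hi
  | zero => exact inner_zero_right _
  | add _ _ _ _ hy hz => rw [inner_add_right, hy, hz, add_zero]
  | smul c _ _ hy => rw [inner_smul_right, hy, mul_zero]

lemma sub_gramSchmidt_mem_span {ι : Type*} [LinearOrder ι] [LocallyFiniteOrderBot ι]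
    [WellFoundedLT ι] (f : ι → E) (k : ι) :
    f k - gramSchmidt 𝕜 f k ∈ Submodule.span 𝕜 (f '' Set.Iio k) := by
  rw [InnerProductSpace.gramSchmidt_def, sub_sub_cancel,
    ← InnerProductSpace.span_gramSchmidt_Iio]
  refine Submodule.sum_mem _ fun i hi => ?_
  rw [Submodule.starProjection_singleton]
  exact Submodule.smul_mem _ _ (Submodule.subset_span ⟨i, mem_Iio.1 hi, rfl⟩)

lemma inner_gramSchmidt_self {ι : Type*} [LinearOrder ι] [LocallyFiniteOrderBot ι]
    [WellFoundedLT ι] (f : ι → E) (k : ι) :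
    ⟪gramSchmidt 𝕜 f k, f k⟫ = ⟪gramSchmidt 𝕜 f k, gramSchmidt 𝕜 f k⟫ := by
  rw [← sub_eq_zero, ← inner_sub_right]
  exact inner_gramSchmidt_eq_zero_of_mem_span (sub_gramSchmidt_mem_span f k)

variable {T : E →ₗ[𝕜] E} {f : ℕ → E} {b : ℕ → 𝕜}

lemma map_mem_span_Iio_succ
    (hT : ∀ k, T (f k) - b k • f (k + 1) ∈ Submodule.span 𝕜 (f '' Set.Iic k)) {k : ℕ} {y : E}
    (hy : y ∈ Submodule.span 𝕜 (f '' Set.Iio k)) :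
    T y ∈ Submodule.span 𝕜 (f '' Set.Iio (k + 1)) := by
  induction hy using Submodule.span_induction with
  | mem _ h =>
    obtain ⟨i, hi, rfl⟩ := h
    rw [← sub_add_cancel (T (f i)) (b i • f (i + 1))]
    refine add_mem (Submodule.span_mono (Set.image_mono fun j hj => ?_) (hT i))
      (Submodule.smul_mem _ _ (Submodule.subset_span ⟨i + 1, Nat.succ_lt_succ hi, rfl⟩))
    exact (hj.trans_lt hi).trans (Nat.lt_succ_self k)
  | zero => simp only [map_zero, zero_mem]
  | add _ _ _ _ hy hz => simpa only [map_add] using add_mem hy hz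
  | smul c _ _ hy => simpa only [map_smul] using Submodule.smul_mem _ c hy

lemma inner_gramSchmidt_map_gramSchmidt_eq_zero
    (hT : ∀ k, T (f k) - b k • f (k + 1) ∈ Submodule.span 𝕜 (f '' Set.Iic k)) {i j : ℕ}
    (hij : i + 1 < j) : ⟪gramSchmidt 𝕜 f j, T (gramSchmidt 𝕜 f i)⟫ = 0 := by
  have hmem : gramSchmidt 𝕜 f i ∈ Submodule.span 𝕜 (f '' Set.Iio (i + 1)) :=
    Submodule.span_mono (Set.image_mono fun _ => Nat.lt_succ_of_le)
      (InnerProductSpace.gramSchmidt_mem_span 𝕜 f le_rfl)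
  exact inner_gramSchmidt_eq_zero_of_mem_span (Submodule.span_mono
    (Set.image_mono (Set.Iio_subset_Iio hij)) (map_mem_span_Iio_succ hT hmem))

lemma inner_gramSchmidt_succ_map_gramSchmidt
    (hT : ∀ k, T (f k) - b k • f (k + 1) ∈ Submodule.span 𝕜 (f '' Set.Iic k)) (k : ℕ) :
    ⟪gramSchmidt 𝕜 f (k + 1), T (gramSchmidt 𝕜 f k)⟫ =
      b k * ⟪gramSchmidt 𝕜 f (k + 1), gramSchmidt 𝕜 f (k + 1)⟫ := by
  have hlower : T (f k - gramSchmidt 𝕜 f k) - (T (f k) - b k • f (k + 1)) ∈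
      Submodule.span 𝕜 (f '' Set.Iio (k + 1)) :=
    sub_mem (map_mem_span_Iio_succ hT (sub_gramSchmidt_mem_span f k))
      (Submodule.span_mono (Set.image_mono fun _ => Nat.lt_succ_of_le) (hT k))
  have hdecomp : T (gramSchmidt 𝕜 f k) = b k • f (k + 1) -
      (T (f k - gramSchmidt 𝕜 f k) - (T (f k) - b k • f (k + 1))) := by
    rw [map_sub]; abel
  rw [hdecomp, inner_sub_right, inner_gramSchmidt_eq_zero_of_mem_span hlower, sub_zero,
    inner_smul_right, inner_gramSchmidt_self]

lemma orthonormal_gramSchmidtNormed_fin {n : ℕ} (hf : ∀ k < n, gramSchmidt 𝕜 f k ≠ 0) :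
    Orthonormal 𝕜 fun k : Fin n => gramSchmidtNormed 𝕜 f k :=
  (InnerProductSpace.gramSchmidtNormed_orthonormal' f).comp
    (fun k : Fin n => ⟨k, smul_ne_zero (by simpa using hf k k.2) (hf k k.2)⟩)
    fun _ _ h => Fin.ext (congrArg Subtype.val h)

lemma inner_gramSchmidtNormed_map_eq_zero_iff {k l : ℕ} (hk : gramSchmidt 𝕜 f k ≠ 0)
    (hl : gramSchmidt 𝕜 f l ≠ 0) :
    ⟪gramSchmidtNormed 𝕜 f k, T (gramSchmidtNormed 𝕜 f l)⟫ = 0 ↔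
      ⟪gramSchmidt 𝕜 f k, T (gramSchmidt 𝕜 f l)⟫ = 0 := by
  simp [gramSchmidtNormed, inner_smul_left, inner_smul_right, hk, hl]

end GramSchmidt

section PathMatrices

lemma mem_symmMatrices_pathGraph {n : ℕ} {A : Matrix (Fin n) (Fin n) ℝ} (hA : A.IsSymm)
    (hfar : ∀ i j : Fin n, (i : ℕ) + 1 < j → A j i = 0)
    (hnext : ∀ i j : Fin n, (i : ℕ) + 1 = j → A j i ≠ 0) :
    A ∈ (pathGraph n).symmMatrices := by
  have hpattern : ∀ i j : Fin n, i < j → (A j i ≠ 0 ↔ (pathGraph n).Adj j i) := by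
    intro i j hij
    have hij' : (i : ℕ) < j := hij
    rw [SimpleGraph.pathGraph_adj]
    rcases (Nat.succ_le_of_lt hij').lt_or_eq with h | h
    · have := hfar i j h
      grind
    · have := hnext i j h
      grind
  refine ⟨hA, fun i j hij => ?_⟩
  rcases hij.lt_or_gt with h | h
  · rw [← hA.apply, SimpleGraph.adj_comm, hpattern i j h]
  · exact hpattern j i h

lemma conjTranspose_mul_mul_apply_eq_inner {𝕜 m ι : Type*} [RCLike 𝕜] [Fintype m] [DecidableEq m]
    (u : ι → EuclideanSpace 𝕜 m) (D : Matrix m m 𝕜) (k l : ι) :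
    ((of fun i k => u k i)ᴴ * D * of fun i k => u k i) k l =
      inner 𝕜 (u k) (toEuclideanLin D (u l)) := by
  rw [Matrix.mul_assoc, EuclideanSpace.inner_eq_star_dotProduct, dotProduct_comm]
  rfl

lemma of_mem_unitary_of_orthonormal {𝕜 m : Type*} [RCLike 𝕜] [Fintype m] [DecidableEq m]
    {u : m → EuclideanSpace 𝕜 m} (hu : Orthonormal 𝕜 u) :
    (of fun i k => u k i) ∈ unitary (Matrix m m 𝕜) := by
  refine mem_unitaryGroup_iff'.2 (ext fun k l => ?_)
  simpa [star_eq_conjTranspose, orthonormal_iff_ite.1 hu, one_apply] using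
    conjTranspose_mul_mul_apply_eq_inner u 1 k l

/-- The Newton polynomials `(X - x 0) ⋯ (X - x (k - 1))` sampled at the points `x i`, with the
`i`-th value scaled by `ε ^ (i - k)`. For `i < k` the exponent is truncated, but the product
vanishes. They satisfy `D f_k = x_k f_k + ε f_{k+1}` for `D = diagonal x`. -/
noncomputable def newtonVector (n : ℕ) (x : ℕ → ℝ) (ε : ℝ) (k : ℕ) : EuclideanSpace ℝ (Fin n) :=
  WithLp.toLp 2 fun i => ε ^ (i - k : ℕ) * ∏ j ∈ range k, (x i - x j)

variable {n : ℕ} {x : ℕ → ℝ}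

lemma newtonVector_apply (ε : ℝ) (k : ℕ) (i : Fin n) :
    newtonVector n x ε k i = ε ^ (i - k : ℕ) * ∏ j ∈ range k, (x i - x j) := rfl

lemma toEuclideanLin_diagonal_newtonVector (ε : ℝ) (k : ℕ) :
    toEuclideanLin (diagonal fun i : Fin n => x i) (newtonVector n x ε k) =
      x k • newtonVector n x ε k + ε • newtonVector n x ε (k + 1) := by
  ext i
  suffices (x i - x k) * newtonVector n x ε k i = ε * newtonVector n x ε (k + 1) i by
    simp only [toLpLin_apply, mulVec_diagonal, PiLp.add_apply, PiLp.smul_apply, smul_eq_mul]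
    linarith
  simp only [newtonVector_apply, prod_range_succ]
  rcases lt_or_ge k i with hki | hik
  · rw [(by omega : (i : ℕ) - k = i - (k + 1) + 1), pow_succ]
    ring
  · have hroot : (∏ j ∈ range k, (x i - x j)) * (x i - x k) = 0 := by
      rw [← prod_range_succ]
      exact prod_eq_zero (mem_range.2 (Nat.lt_succ_of_le hik)) (sub_self _)
    linear_combination (ε ^ (i - k : ℕ) - ε * ε ^ (i - (k + 1) : ℕ)) * hroot

lemma newtonVector_zero_apply_of_ne {k : ℕ} {i : Fin n} (hik : (i : ℕ) ≠ k) :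
    newtonVector n x 0 k i = 0 := by
  rw [newtonVector_apply]
  rcases hik.lt_or_gt with h | h
  · rw [prod_eq_zero (mem_range.2 h) (sub_self _), mul_zero]
  · rw [zero_pow (Nat.sub_ne_zero_of_lt h), zero_mul]

lemma pairwise_inner_newtonVector_zero :
    Pairwise fun k l => inner ℝ (newtonVector n x 0 k) (newtonVector n x 0 l) = 0 := by
  intro k l hkl
  rw [PiLp.inner_apply]
  refine sum_eq_zero fun i _ => ?_
  rcases eq_or_ne (i : ℕ) k with rfl | hik
  · rw [newtonVector_zero_apply_of_ne hkl, inner_zero_right]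
  · rw [newtonVector_zero_apply_of_ne hik, inner_zero_left]

lemma newtonVector_ne_zero (hx : Set.InjOn x (Set.Iio n)) (ε : ℝ) {k : ℕ} (hk : k < n) :
    newtonVector n x ε k ≠ 0 := by
  intro h
  have hcoord : newtonVector n x ε k ⟨k, hk⟩ ≠ 0 := by
    rw [newtonVector_apply, Nat.sub_self, pow_zero, one_mul]
    refine prod_ne_zero_iff.2 fun j hj => sub_ne_zero.2 fun heq => ?_
    have hjk := mem_range.1 hj
    exact hjk.ne' (hx hk (hjk.trans hk) heq)
  exact hcoord (by rw [h]; rfl)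

lemma continuous_newtonVector (k : ℕ) : Continuous fun ε => newtonVector n x ε k := by
  unfold newtonVector
  fun_prop

lemma eventually_inner_gramSchmidt_newtonVector_ne_zero (hx : Set.InjOn x (Set.Iio n))
    (hx0 : ∀ k < n, x k ≠ 0) :
    ∀ᶠ ε in nhds 0, ∀ k < n, inner ℝ (gramSchmidt ℝ (newtonVector n x ε) k)
      (toEuclideanLin (diagonal fun i : Fin n => x i)
        (gramSchmidt ℝ (newtonVector n x ε) k)) ≠ 0 := by
  have hgs : gramSchmidt ℝ (newtonVector n x 0) = newtonVector n x 0 :=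
    InnerProductSpace.gramSchmidt_of_orthogonal ℝ pairwise_inner_newtonVector_zero
  refine (Set.finite_Iio n).eventually_all.2 fun k hk => ?_
  have hcont : ContinuousAt (fun ε => gramSchmidt ℝ (newtonVector n x ε) k) 0 :=
    continuousAt_gramSchmidt (fun k => (continuous_newtonVector k).continuousAt) fun j hj => by
      rw [hgs]
      exact newtonVector_ne_zero hx 0 (hj.trans hk)
  have hT := (toEuclideanLin (diagonal fun i : Fin n => x i)).continuous_of_finiteDimensional
  refine (Filter.Tendsto.inner hcont (hT.continuousAt.comp hcont)).eventually_ne ?_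
  simp only [Function.comp_apply, hgs, toEuclideanLin_diagonal_newtonVector, zero_smul, add_zero,
    inner_smul_right]
  exact mul_ne_zero (hx0 k hk) (inner_self_ne_zero.2 (newtonVector_ne_zero hx 0 hk))

lemma exists_unitary_conj_mem_symmMatrices_pathGraph {x : Fin n → ℝ} (hx : Function.Injective x)
    (hx0 : ∀ i, x i ≠ 0) :
    ∃ U ∈ unitary (Matrix (Fin n) (Fin n) ℝ),
      Uᴴ * diagonal x * U ∈ (pathGraph n).symmMatrices ∧
        ∀ i, (Uᴴ * diagonal x * U) i i ≠ 0 := by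
  obtain ⟨x, rfl⟩ := Fin.val_injective.surjective_comp_right x
  have hxInj : Set.InjOn x (Set.Iio n) := fun i hi j hj h =>
    Fin.val_eq_of_eq (@hx ⟨i, hi⟩ ⟨j, hj⟩ h)
  obtain ⟨ε, hdiag, hε⟩ := (((eventually_inner_gramSchmidt_newtonVector_ne_zero hxInj
    fun k hk => hx0 ⟨k, hk⟩).filter_mono nhdsWithin_le_nhds).and
    (self_mem_nhdsWithin (s := {(0 : ℝ)}ᶜ))).exists
  have hgs : ∀ k < n, gramSchmidt ℝ (newtonVector n x ε) k ≠ 0 := fun k hk h =>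
    hdiag k hk (by rw [h, inner_zero_left])
  have hT : ∀ k, toEuclideanLin (diagonal fun i : Fin n => x i) (newtonVector n x ε k) -
      ε • newtonVector n x ε (k + 1) ∈ Submodule.span ℝ (newtonVector n x ε '' Set.Iic k) := by
    intro k
    rw [toEuclideanLin_diagonal_newtonVector, add_sub_cancel_right]
    exact Submodule.smul_mem _ _ (Submodule.subset_span ⟨k, Set.self_mem_Iic, rfl⟩)
  set U : Matrix (Fin n) (Fin n) ℝ :=
    of fun i k => gramSchmidtNormed ℝ (newtonVector n x ε) (k : ℕ) i
  have hentry : ∀ k l : Fin n, (Uᴴ * diagonal (fun i : Fin n => x i) * U) k l = 0 ↔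
      inner ℝ (gramSchmidt ℝ (newtonVector n x ε) k) (toEuclideanLin
        (diagonal fun i : Fin n => x i) (gramSchmidt ℝ (newtonVector n x ε) l)) = 0 := by
    intro k l
    rw [conjTranspose_mul_mul_apply_eq_inner
      (fun k : Fin n => gramSchmidtNormed ℝ (newtonVector n x ε) k),
      inner_gramSchmidtNormed_map_eq_zero_iff (hgs k k.2) (hgs l l.2)]
  have hsymm : (Uᴴ * diagonal (fun i : Fin n => x i) * U).IsSymm :=
    isHermitian_iff_isSymm.1 (isHermitian_conjTranspose_mul_mul U (isHermitian_diagonal _))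
  refine ⟨U, of_mem_unitary_of_orthonormal (orthonormal_gramSchmidtNormed_fin hgs),
    mem_symmMatrices_pathGraph hsymm (fun i j hij => ?_) (fun i j hij => ?_),
    fun i => (hentry i i).not.2 (hdiag i i.2)⟩
  · exact (hentry j i).2 (inner_gramSchmidt_map_gramSchmidt_eq_zero hT hij)
  · refine (hentry j i).not.2 ?_
    rw [← hij, inner_gramSchmidt_succ_map_gramSchmidt hT]
    exact mul_ne_zero hε (inner_self_ne_zero.2 (hgs _ (hij ▸ j.2)))

end PathMatrices

section Spectra

lemma distinctEigenvalues_eq_spectrum {V : Type*} [Fintype V] [DecidableEq V]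
    (A : Matrix V V ℝ) : A.distinctEigenvalues = spectrum ℝ A := by
  ext μ
  rw [Matrix.distinctEigenvalues, Set.mem_ofPred_eq, Module.End.hasEigenvalue_iff_mem_spectrum,
    Matrix.spectrum_toLin']

lemma distinctEigenvalues_conjTranspose_mul_diagonal_mul {V : Type*} [Fintype V] [DecidableEq V]
    {U : Matrix V V ℝ} (hU : U ∈ unitary (Matrix V V ℝ)) (d : V → ℝ) :
    (Uᴴ * diagonal d * U).distinctEigenvalues = Set.range d := by
  rw [distinctEigenvalues_eq_spectrum, ← star_eq_conjTranspose,
    Unitary.spectrum_star_left_conjugate (U := ⟨U, hU⟩), spectrum_diagonal]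

lemma kronecker_mem_symmMatrices {V W : Type*} {G : SimpleGraph V} {H : SimpleGraph W}
    {A : Matrix V V ℝ} {B : Matrix W W ℝ} (hA : A ∈ G.symmMatrices) (hB : B ∈ H.symmMatrices)
    (hA0 : ∀ i, A i i ≠ 0) (hB0 : ∀ i, B i i ≠ 0) :
    A ⊗ₖ B ∈ (G.strongProd H).symmMatrices := by
  constructor
  · rw [Matrix.IsSymm, ← kroneckerMap_transpose, hA.1.eq, hB.1.eq]
  · rintro ⟨i, i'⟩ ⟨j, j'⟩ hij
    rcases eq_or_ne i j with rfl | h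
    · have h' : i' ≠ j' := fun h' => hij (by rw [h'])
      simp [SimpleGraph.strongProd, hA0, hB.2 _ _ h', h']
    · rcases eq_or_ne i' j' with rfl | h'
      · simp [SimpleGraph.strongProd, hB0, hA.2 _ _ h, h]
      · simp [SimpleGraph.strongProd, hA.2 _ _ h, hB.2 _ _ h', h, h', and_comm]

lemma minDistinctEigenvalues_strongProd_pathGraph_le_card_mul {S T : Finset ℝ} (hS : 0 ∉ S)
    (hT : 0 ∉ T) :
    ((pathGraph #S).strongProd (pathGraph #T)).minDistinctEigenvalues ≤ #(S * T) := by
  let x := S.orderEmbOfFin rfl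
  let y := T.orderEmbOfFin rfl
  have hxS : ∀ i, x i ∈ S := S.orderEmbOfFin_mem rfl
  have hyT : ∀ j, y j ∈ T := T.orderEmbOfFin_mem rfl
  obtain ⟨U, hU, hA, hA0⟩ := exists_unitary_conj_mem_symmMatrices_pathGraph x.injective
    fun i => ne_of_mem_of_not_mem (hxS i) hS
  obtain ⟨U', hU', hB, hB0⟩ := exists_unitary_conj_mem_symmMatrices_pathGraph y.injective
    fun j => ne_of_mem_of_not_mem (hyT j) hT
  refine ((SimpleGraph.isLeast_minDistinctEigenvalues _).2
    ⟨_, kronecker_mem_symmMatrices hA hB hA0 hB0, rfl⟩).trans ?_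
  rw [mul_kronecker_mul, mul_kronecker_mul, diagonal_kronecker_diagonal, ← conjTranspose_kronecker,
    Matrix.numDistinctEigenvalues,
    distinctEigenvalues_conjTranspose_mul_diagonal_mul (kronecker_mem_unitary hU hU')]
  refine (Set.ncard_le_ncard ?_ (finite_toSet (S * T))).trans_eq (Set.ncard_coe_finset _)
  rintro _ ⟨⟨i, j⟩, rfl⟩
  exact mem_coe.2 (mul_mem_mul (hxS i) (hyT j))

end Spectra

section Walks

variable {V : Type*} [Fintype V] [DecidableEq V] {G : SimpleGraph V} {A : Matrix V V ℝ}

lemma exists_walk_length_le_of_pow_apply_ne_zero (hA : A ∈ G.symmMatrices) (k : ℕ) {u v : V}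
    (h : (A ^ k) u v ≠ 0) : ∃ p : G.Walk u v, p.length ≤ k := by
  induction k generalizing u with
  | zero =>
    obtain rfl : u = v := of_not_not fun huv => h (by rw [pow_zero, one_apply_ne huv])
    exact ⟨.nil, le_rfl⟩
  | succ k ih =>
    rw [pow_succ', mul_apply] at h
    obtain ⟨w, -, hw⟩ := exists_ne_zero_of_sum_ne_zero h
    obtain ⟨p, hp⟩ := ih (right_ne_zero_of_mul hw)
    rcases eq_or_ne u w with rfl | huw
    · exact ⟨p, hp.trans k.le_succ⟩
    · exact ⟨.cons ((hA.2 u w huw).1 (left_ne_zero_of_mul hw)) p, Nat.succ_le_succ hp⟩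

lemma pow_length_apply_ne_zero (hA : A ∈ G.symmMatrices) {u v : V} (w : G.Walk u v)
    (hw : ∀ p : G.Walk u v, p.length ≤ w.length → p = w) : (A ^ w.length) u v ≠ 0 := by
  induction w with
  | nil =>
    rw [SimpleGraph.Walk.length_nil, pow_zero, one_apply_eq]
    exact one_ne_zero
  | @cons u y v hadj w ih =>
    have hw' : ∀ p : G.Walk y v, p.length ≤ w.length → p = w := fun p hp => by
      simpa using hw (.cons hadj p) (Nat.succ_le_succ hp)
    rw [SimpleGraph.Walk.length_cons, pow_succ', mul_apply, sum_eq_single y]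
    · exact mul_ne_zero ((hA.2 u y hadj.ne).2 hadj) (ih hw')
    · intro z _ hzy
      by_contra h
      obtain ⟨p, hp⟩ := exists_walk_length_le_of_pow_apply_ne_zero hA _ (right_ne_zero_of_mul h)
      rcases eq_or_ne u z with rfl | huz
      · have hlength := congrArg SimpleGraph.Walk.length (hw p (hp.trans (Nat.le_succ _)))
        rw [SimpleGraph.Walk.length_cons] at hlength
        omega
      · have hcons := hw (.cons ((hA.2 u z huz).1 (left_ne_zero_of_mul h)) p) (Nat.succ_le_succ hp)
        exact hzy (by injection hcons)
    · exact fun h => absurd (mem_univ y) h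

lemma aeval_prod_distinctEigenvalues_eq_zero (hA : A.IsSymm) :
    aeval A (∏ μ ∈ A.finite_distinctEigenvalues.toFinset, (X - C μ)) = 0 := by
  have hself : IsSelfAdjoint A := (conjTranspose_eq_transpose_of_trivial A).trans hA
  rw [← cfc_polynomial _ A hself]
  refine (cfc_congr fun μ hμ => ?_).trans (cfc_const_zero ℝ A)
  rw [← distinctEigenvalues_eq_spectrum, ← Set.Finite.mem_toFinset A.finite_distinctEigenvalues]
    at hμ
  rw [Polynomial.eval_prod]
  exact prod_eq_zero hμ (by simp)

lemma aeval_apply_eq_coeff_mul_pow_apply (hA : A ∈ G.symmMatrices) {u v : V} (w : G.Walk u v)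
    (hw : ∀ p : G.Walk u v, p.length ≤ w.length → p = w) {f : Polynomial ℝ}
    (hf : f.natDegree ≤ w.length) :
    aeval A f u v = f.coeff w.length * (A ^ w.length) u v := by
  rw [Polynomial.aeval_eq_sum_range' (Nat.lt_succ_of_le hf), sum_range_succ, Matrix.add_apply,
    Matrix.smul_apply, smul_eq_mul, add_eq_right, Matrix.sum_apply]
  refine sum_eq_zero fun i hi => ?_
  have hlt := mem_range.1 hi
  rw [Matrix.smul_apply, smul_eq_mul, mul_eq_zero]
  by_contra! h
  obtain ⟨p, hp⟩ := exists_walk_length_le_of_pow_apply_ne_zero hA i h.2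
  rw [hw p (hp.trans hlt.le)] at hp
  exact hp.not_gt hlt

theorem length_lt_numDistinctEigenvalues (hA : A ∈ G.symmMatrices) {u v : V} (w : G.Walk u v)
    (hw : ∀ p : G.Walk u v, p.length ≤ w.length → p = w) :
    w.length < A.numDistinctEigenvalues := by
  by_contra! hle
  set f := ∏ μ ∈ A.finite_distinctEigenvalues.toFinset, (X - C μ)
  have hf : f.Monic := Polynomial.monic_prod_X_sub_C _ _
  have hfdeg : f.natDegree = A.numDistinctEigenvalues := by
    rw [Polynomial.natDegree_finsetProd_X_sub_C_eq_card, Matrix.numDistinctEigenvalues,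
      Set.ncard_eq_toFinset_card _ A.finite_distinctEigenvalues]
  set g := X ^ (w.length - A.numDistinctEigenvalues) * f
  have hg : g.Monic := (Polynomial.monic_X_pow _).mul hf
  have hgdeg : g.natDegree = w.length := by
    rw [(Polynomial.monic_X_pow _).natDegree_mul hf, Polynomial.natDegree_X_pow, hfdeg,
      Nat.sub_add_cancel hle]
  have hg0 : aeval A g = 0 := by
    rw [map_mul, aeval_prod_distinctEigenvalues_eq_zero hA.1, mul_zero]
  have hentry := aeval_apply_eq_coeff_mul_pow_apply hA w hw hgdeg.le
  rw [hg0, Matrix.zero_apply, ← hgdeg, hg.coeff_natDegree, one_mul, hgdeg] at hentry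
  exact pow_length_apply_ne_zero hA w hw hentry.symm

end Walks

section StrongProduct

variable {m n : ℕ}

lemma strongProd_pathGraph_adj_le {x y : Fin m × Fin n}
    (h : ((pathGraph m).strongProd (pathGraph n)).Adj x y) :
    (y.1 : ℕ) ≤ x.1 + 1 ∧ (y.2 : ℕ) ≤ x.2 + 1 := by
  simp only [SimpleGraph.strongProd, SimpleGraph.pathGraph_adj, Fin.ext_iff] at h
  omega

lemma val_le_val_add_length_strongProd_pathGraph {x y : Fin m × Fin n}
    (w : ((pathGraph m).strongProd (pathGraph n)).Walk x y) :
    (y.1 : ℕ) ≤ x.1 + w.length ∧ (y.2 : ℕ) ≤ x.2 + w.length := by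
  induction w with
  | nil => exact ⟨le_rfl, le_rfl⟩
  | cons h p ih =>
    have hstep := strongProd_pathGraph_adj_le h
    rw [SimpleGraph.Walk.length_cons]
    omega

lemma eq_of_length_le_strongProd_pathGraph {x y : Fin m × Fin n}
    (p q : ((pathGraph m).strongProd (pathGraph n)).Walk x y)
    (hy₁ : (y.1 : ℕ) = x.1 + q.length) (hy₂ : (y.2 : ℕ) = x.2 + q.length)
    (hpq : p.length ≤ q.length) : p = q := by
  induction q with
  | nil => exact (SimpleGraph.Walk.length_eq_zero_iff.1 (Nat.le_zero.1 hpq)).eq_nil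
  | @cons x z y h q ih =>
    cases p with
    | nil =>
      rw [SimpleGraph.Walk.length_cons] at hy₁
      omega
    | @cons _ z' _ h' p =>
      simp only [SimpleGraph.Walk.length_cons] at hy₁ hy₂ hpq
      have hz := strongProd_pathGraph_adj_le h
      have hz' := strongProd_pathGraph_adj_le h'
      have hq := val_le_val_add_length_strongProd_pathGraph q
      have hp := val_le_val_add_length_strongProd_pathGraph p
      obtain rfl : z' = z := Prod.ext (Fin.ext (by omega)) (Fin.ext (by omega))
      rw [ih p (by omega) (by omega) (by omega)]

lemma exists_diagonal_walk_strongProd_pathGraph {k : ℕ} (hm : k < m) (hn : k < n) :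
    ∃ w : ((pathGraph m).strongProd (pathGraph n)).Walk
      (⟨0, k.zero_le.trans_lt hm⟩, ⟨0, k.zero_le.trans_lt hn⟩) (⟨k, hm⟩, ⟨k, hn⟩),
      w.length = k := by
  induction k with
  | zero => exact ⟨.nil, rfl⟩
  | succ k ih =>
    obtain ⟨w, hw⟩ := ih (k.lt_succ_self.trans hm) (k.lt_succ_self.trans hn)
    have hadj : ((pathGraph m).strongProd (pathGraph n)).Adj (⟨k, k.lt_succ_self.trans hm⟩,
        ⟨k, k.lt_succ_self.trans hn⟩) (⟨k + 1, hm⟩, ⟨k + 1, hn⟩) :=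
      Or.inr (Or.inr ⟨SimpleGraph.pathGraph_adj.2 (Or.inl rfl),
        SimpleGraph.pathGraph_adj.2 (Or.inl rfl)⟩)
    exact ⟨w.concat hadj, by rw [SimpleGraph.Walk.length_concat, hw]⟩

theorem lt_minDistinctEigenvalues_strongProd_pathGraph {k : ℕ} (hm : k < m) (hn : k < n) :
    k < ((pathGraph m).strongProd (pathGraph n)).minDistinctEigenvalues := by
  obtain ⟨A, hA, hAq⟩ :=
    (SimpleGraph.isLeast_minDistinctEigenvalues ((pathGraph m).strongProd (pathGraph n))).1
  obtain ⟨w, hw⟩ := exists_diagonal_walk_strongProd_pathGraph hm hn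
  have hy : k = 0 + w.length := by rw [hw, Nat.zero_add]
  rw [← hAq, ← hw]
  exact length_lt_numDistinctEigenvalues hA w fun p =>
    eq_of_length_le_strongProd_pathGraph p w hy hy

end StrongProduct

section ProductSets

/-- The first `a` powers of two, starting from `1`. Any other base `> 1` would do as well: only
`powersOfTwo a * powersOfTwo b ⊆ powersOfTwo (a + b - 1)` matters. -/
noncomputable def powersOfTwo (a : ℕ) : Finset ℝ := (range a).image (2 ^ ·)

lemma pos_of_mem_powersOfTwo {a : ℕ} {x : ℝ} (hx : x ∈ powersOfTwo a) : 0 < x := by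
  obtain ⟨i, -, rfl⟩ := mem_image.1 hx
  positivity

lemma card_powersOfTwo (a : ℕ) : #(powersOfTwo a) = a := by
  rw [powersOfTwo, card_image_of_injective _ (pow_right_injective₀ two_pos (by norm_num)),
    card_range]

lemma powersOfTwo_mul_subset (a b : ℕ) :
    powersOfTwo a * powersOfTwo b ⊆ powersOfTwo (a + b - 1) := by
  refine mul_subset_iff.2 fun x hx y hy => ?_
  obtain ⟨i, hi, rfl⟩ := mem_image.1 hx
  obtain ⟨j, hj, rfl⟩ := mem_image.1 hy
  rw [mem_range] at hi hj
  exact mem_image.2 ⟨i + j, mem_range.2 (by omega), pow_add _ _ _⟩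

lemma card_union_neg {α : Type*} [AddCommGroup α] [LinearOrder α] [IsOrderedAddMonoid α]
    {S : Finset α} (hS : ∀ x ∈ S, 0 < x) : #(S ∪ -S) = 2 * #S := by
  have hdisj : Disjoint S (-S) := disjoint_left.2 fun x hx hx' =>
    (hS x hx).not_gt (neg_pos.1 (hS _ (mem_neg'.1 hx')))
  rw [card_union_of_disjoint hdisj, card_neg, two_mul]

lemma union_neg_mul_union_neg {α : Type*} [DecidableEq α] [Mul α] [HasDistribNeg α]
    (S T : Finset α) :
    (S ∪ -S) * (T ∪ -T) = S * T ∪ -(S * T) := by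
  simp only [union_mul, mul_union, neg_mul, mul_neg]
  ext x
  simp only [mem_union, mem_neg', neg_neg]
  tauto

end ProductSets

theorem minDistinctEigenvalues_strongProd_pathGraph_le (a b : ℕ) :
    ((pathGraph a).strongProd (pathGraph b)).minDistinctEigenvalues ≤ a + b - 1 := by
  have h := minDistinctEigenvalues_strongProd_pathGraph_le_card_mul
    (fun h => (pos_of_mem_powersOfTwo (a := a) h).false)
    (fun h => (pos_of_mem_powersOfTwo (a := b) h).false)
  rw [card_powersOfTwo, card_powersOfTwo] at h
  exact h.trans ((card_le_card (powersOfTwo_mul_subset a b)).trans_eq (card_powersOfTwo _))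

theorem minDistinctEigenvalues_strongProd_pathGraph_two_mul_le (a b : ℕ) :
    ((pathGraph (2 * a)).strongProd (pathGraph (2 * b))).minDistinctEigenvalues ≤
      2 * (a + b - 1) := by
  have hzero : ∀ c, (0 : ℝ) ∉ powersOfTwo c ∪ -powersOfTwo c := fun c h => by
    rw [mem_union, mem_neg', neg_zero, or_self] at h
    exact (pos_of_mem_powersOfTwo h).false
  have hcard : ∀ c, #(powersOfTwo c ∪ -powersOfTwo c) = 2 * c := fun c => by
    rw [card_union_neg fun _ => pos_of_mem_powersOfTwo, card_powersOfTwo]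
  have h := minDistinctEigenvalues_strongProd_pathGraph_le_card_mul (hzero a) (hzero b)
  rw [hcard, hcard, union_neg_mul_union_neg] at h
  calc
    _ ≤ #(powersOfTwo a * powersOfTwo b ∪ -(powersOfTwo a * powersOfTwo b)) := h
    _ ≤ #(powersOfTwo (a + b - 1) ∪ -powersOfTwo (a + b - 1)) :=
      card_le_card (union_subset_union (powersOfTwo_mul_subset a b)
        (neg_subset_neg (powersOfTwo_mul_subset a b)))
    _ = 2 * (a + b - 1) := hcard _

theorem mainTheorem11 (s s' : ℕ) (hs : 2 ≤ s) (hss' : s ≤ s') :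
    s ≤ ((SimpleGraph.pathGraph s).strongProd (SimpleGraph.pathGraph s')).minDistinctEigenvalues ∧
    ((SimpleGraph.pathGraph s).strongProd (SimpleGraph.pathGraph s')).minDistinctEigenvalues ≤
      (if Even s ∧ Even s' then s + s' - 2 else s + s' - 1) := by
  refine ⟨Nat.le_of_pred_lt (lt_minDistinctEigenvalues_strongProd_pathGraph
    (Nat.pred_lt (by omega)) (by rw [Nat.pred_eq_sub_one]; omega)), ?_⟩
  split_ifs with h
  · obtain ⟨⟨a, rfl⟩, ⟨b, rfl⟩⟩ := h
    rw [← two_mul, ← two_mul]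
    exact (minDistinctEigenvalues_strongProd_pathGraph_two_mul_le a b).trans (by omega)
  · exact minDistinctEigenvalues_strongProd_pathGraph_le s s'
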